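/- Let $(E_i,\pi_i,M_i,\rho_i)_{i\in\mathbb N}$ be a strong projective system of Banach Lie algebroids. That is: each $E_i\to M_i$ is a smooth Banach vector bundle over a Banach manifold, carrying a Lie algebroid structure with anchor $\rho_i:E_i\to TM_i$; for $j\ge i$ there are smooth maps $\delta_i^j:M_j\to M_i$ and Lie algebroid morphisms $f_i^j:E_j\to E_i$ over $\delta_i^j$, forming projective systems, with $\rho_i\circ f_i^j=T\delta_i^j\circ\rho_j$; the model spaces $\mathbb M_i$ of $M_i$ and the typical fibres $\mathbb E_i$ of $E_i$ form projective systems of Banach spaces; and around every point $(x_i)$ of $M=\varprojlim M_i$ there are projective systems of charts $\varphi_i:U_i\to\mathbb M_i$ of the $M_i$ and of trivializations $\tau_i:\pi_i^{-1}(V_i)\to V_i\times\mathbb E_i$, compatible with the transition maps, with $\varprojlim U_i$ and $\varprojlim V_i$ open in $M$. Put $E=\varprojlim E_i$, $\pi=\varprojlim\pi_i$, $\rho=\varprojlim\rho_i$, $TE=\varprojlim TE_i$, $TM=\varprojlim TM_i$, with $\tau_E:TE\to E$ the projection; smoothness and velocities of curves in $M$, $E$, $TE$ are taken in the limit charts,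 with values in Fréchet spaces, and a map is smooth if it maps smooth curves to smooth curves. Intervals are nondegenerate. A curve $\gamma:J\to E_i$ (or $c:J\to E$) on an interval $J$ is admissible if $(\pi_i\circ\gamma)'=\rho_i(\gamma)$ (resp. $(\pi\circ c)'=\rho(c)$) on $J$. A smooth vector field $S$ on $E_i$ (or $E$), that is, a smooth map into the tangent bundle with $\tau\circ S=\mathrm{Id}$, is a semispray if $T\pi_i\circ S=\rho_i$ (resp. $T\pi\circ S=\rho$). An integral curve of $S$ on $J$ is a smooth curve $c$ with $c'=S(c)$ on $J$. (1) If $\gamma_i:J\to E_i$ are admissible curves on an interval $J$ with $f_i^j\circ\gamma_j=\gamma_i$ for $j\ge i$, then $\gamma=\varprojlim\gamma_i:J\to E$ is admissible; it is smooth if all $\gamma_i$ are. (2) Let $S_i$ be smooth vector fields on $E_i$ with $Tf_i^j\circ S_j=S_i\circ f_i^j$ for $j\ge i$. Then $S=\varprojlim S_i:(u_0,u_1,\dots)\mapsto(S_0(u_0),S_1(u_1),\dots)$ is a smooth vector field on $E$; in particular $\tau_E\circ S=\mathrm{Id}_E$. If all $S_i$ are semisprays, then $T\pi\circ S=\rho$,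 so $S$ is a semispray. (3) Let $S=\varprojlim S_i$ be as in (2), and let $\mathcal J$ be any family of intervals (for instance all intervals, or $[0,1]$ only). If $S$ is a semispray, then all integral curves of $S$ on intervals $J\in\mathcal J$ are admissible. Conversely, if all these integral curves are admissible, then $T\pi(S(u))=\rho(u)$ at every point $u\in E$ that lies on one of them. Consequently, if all $S_i$ are semisprays, or if every point of $E$ lies on an integral curve of $S$ on some $J\in\mathcal J$, then $S$ is a semispray if and only if all integral curves of $S$ on intervals $J\in\mathcal J$ are admissible curves. -/

import Mathlib

open Set Filter Topology Bundle
open scoped Manifold ContDiff Bundle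

noncomputable section

/-! ### Banach Lie algebroids -/

/-- The derivative `X(g) = dg(X)` of a function `g` along a tangent vector `X`. -/
def dirDeriv {B : Type*} [NormedAddCommGroup B] [NormedSpace ℝ B]
    {M : Type*} [TopologicalSpace M] [ChartedSpace B M] (g : M → ℝ) {x : M}
    (X : TangentSpace 𝓘(ℝ, B) x) : ℝ :=
  mfderiv 𝓘(ℝ, B) 𝓘(ℝ) g x X

/-- A Banach Lie algebroid `(E, π, M, ρ)` over a Banach manifold `M` (modelled on `B`), where `E` is
a smooth Banach vector bundle with typical fibre `F`: an anchor `ρ : E → TM`, which is a smooth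
vector bundle morphism, and a real Lie algebra structure on the space of smooth sections of `E`, such
that the anchor induces a Lie algebra morphism into the vector fields of `M` and the Leibniz rule
holds. -/
structure BanachLieAlgebroid (B F : Type*) [NormedAddCommGroup B] [NormedSpace ℝ B]
    [NormedAddCommGroup F] [NormedSpace ℝ F]
    {M : Type*} [TopologicalSpace M] [ChartedSpace B M] [IsManifold 𝓘(ℝ, B) ∞ M]
    (E : M → Type*) [∀ x, AddCommGroup (E x)] [∀ x, Module ℝ (E x)] [∀ x, TopologicalSpace (E x)]
    [TopologicalSpace (TotalSpace F E)] [FiberBundle F E] [VectorBundle ℝ F E]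
    [ContMDiffVectorBundle ∞ F E 𝓘(ℝ, B)] where
  /-- The anchor, fibre by fibre. -/
  anchor : ∀ x : M, E x →L[ℝ] TangentSpace 𝓘(ℝ, B) x
  contMDiff_anchor : ContMDiff (𝓘(ℝ, B).prod 𝓘(ℝ, F)) 𝓘(ℝ, B).tangent ∞
    (fun u : TotalSpace F E ↦ (⟨u.proj, anchor u.proj u.2⟩ : TangentBundle 𝓘(ℝ, B) M))
  /-- The bracket of smooth sections. -/
  bracket : Cₛ^∞⟮𝓘(ℝ, B); F, E⟯ →ₗ[ℝ] Cₛ^∞⟮𝓘(ℝ, B); F, E⟯ →ₗ[ℝ] Cₛ^∞⟮𝓘(ℝ, B); F, E⟯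
  bracket_self : ∀ s, bracket s s = 0
  jacobi : ∀ s₁ s₂ s₃, bracket s₁ (bracket s₂ s₃) + bracket s₂ (bracket s₃ s₁) +
    bracket s₃ (bracket s₁ s₂) = 0
  anchor_bracket : ∀ s₁ s₂ x, anchor x (bracket s₁ s₂ x) =
    VectorField.mlieBracket 𝓘(ℝ, B) (fun y ↦ anchor y (s₁ y)) (fun y ↦ anchor y (s₂ y)) x
  leibniz : ∀ (s₁ s₂ : Cₛ^∞⟮𝓘(ℝ, B); F, E⟯) (g : M → ℝ) (hg : ContMDiff 𝓘(ℝ, B) 𝓘(ℝ) ∞ g) (x : M),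
    bracket s₁ ⟨g • ⇑s₂, hg.smul_section s₂.contMDiff⟩ x =
      g x • bracket s₁ s₂ x + dirDeriv g (anchor x (s₁ x)) • s₂ x

namespace BanachLieAlgebroid

section Single

variable {B F : Type*} [NormedAddCommGroup B] [NormedSpace ℝ B]
  [NormedAddCommGroup F] [NormedSpace ℝ F]
  {M : Type*} [TopologicalSpace M] [ChartedSpace B M] [IsManifold 𝓘(ℝ, B) ∞ M]
  {E : M → Type*} [∀ x, AddCommGroup (E x)] [∀ x, Module ℝ (E x)] [∀ x, TopologicalSpace (E x)]
  [TopologicalSpace (TotalSpace F E)] [FiberBundle F E] [VectorBundle ℝ F E]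
  [ContMDiffVectorBundle ∞ F E 𝓘(ℝ, B)]

/-- The anchor as a map `ρ : E → TM`. -/
def rho (A : BanachLieAlgebroid B F E) (u : TotalSpace F E) : TangentBundle 𝓘(ℝ, B) M :=
  ⟨u.proj, A.anchor u.proj u.2⟩

variable (B F) in
/-- A field of continuous alternating `q`-forms on the fibres of `E` is smooth if it is so when read
in the trivializations of `E`; smooth fields are the sections of `Λ^q E*`. -/
def IsSmoothForm {q : ℕ} (α : ∀ x : M, E x [⋀^Fin q]→L[ℝ] ℝ) : Prop :=
  ∀ x₀ : M, ContMDiffOn 𝓘(ℝ, B) 𝓘(ℝ, F [⋀^Fin q]→L[ℝ] ℝ) ∞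
    (fun x ↦ (α x).compContinuousLinearMap ((trivializationAt F E x₀).symmL ℝ x))
    (trivializationAt F E x₀).baseSet

/-- The term `∑_{i<j} (-1)^{i+j} α([s_i, s_j], s_0, …, ŝ_i, …, ŝ_j, …, s_q)` of the exterior
derivative of a `q`-form `α` (it is an empty sum if `q = 0`). -/
def bracketTerm (A : BanachLieAlgebroid B F E) : ∀ {q : ℕ} (_ : ∀ x : M, E x [⋀^Fin q]→L[ℝ] ℝ)
    (_ : Fin (q + 1) → Cₛ^∞⟮𝓘(ℝ, B); F, E⟯) (_ : M), ℝ
  | 0, _, _, _ => 0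
  | n + 1, α, s, x => ∑ j : Fin (n + 2), ∑ i : Fin (n + 1),
      if i.castSucc < j then
        (-1 : ℝ) ^ ((i : ℕ) + (j : ℕ)) *
          α x (Fin.cons (A.bracket (s i.castSucc) (s j) x)
            (fun k : Fin n ↦ s (j.succAbove (i.succAbove k)) x))
      else 0

/-- `β = d_ρ α`: the value of the `(q+1)`-form `β` on all families of sections is
`∑_i (-1)^i ρ(s_i)(α(s_0, …, ŝ_i, …, s_q)) + ∑_{i<j} (-1)^{i+j} α([s_i, s_j], …, ŝ_i, …, ŝ_j, …)`. -/
def IsExtDeriv (A : BanachLieAlgebroid B F E) {q : ℕ} (α : ∀ x : M, E x [⋀^Fin q]→L[ℝ] ℝ)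
    (β : ∀ x : M, E x [⋀^Fin (q + 1)]→L[ℝ] ℝ) : Prop :=
  ∀ (s : Fin (q + 1) → Cₛ^∞⟮𝓘(ℝ, B); F, E⟯) (x : M),
    β x (fun k ↦ s k x) =
      ∑ i : Fin (q + 1), (-1 : ℝ) ^ (i : ℕ) *
        dirDeriv (fun y ↦ α y (fun k ↦ s (i.succAbove k) y)) (A.anchor x (s i x))
      + A.bracketTerm α s x

/-- Admissible curves in a Banach Lie algebroid, on a set `J` of times: `(π ∘ γ)' = ρ(γ)` on `J`. -/
def IsAdmissibleOn (A : BanachLieAlgebroid B F E) (γ : ℝ → TotalSpace F E) (J : Set ℝ) : Prop :=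
  ∀ t ∈ J, HasMFDerivWithinAt 𝓘(ℝ) 𝓘(ℝ, B) (fun s ↦ (γ s).proj) J t
    ((1 : ℝ →L[ℝ] ℝ).smulRight (A.anchor (γ t).proj (γ t).2))

variable (B F) in
/-- Smooth vector fields on the total space `E`, as smooth sections `S : E → TE`. -/
structure IsVectorField
    (S : TotalSpace F E → TangentBundle (𝓘(ℝ, B).prod 𝓘(ℝ, F)) (TotalSpace F E)) : Prop where
  contMDiff : ContMDiff (𝓘(ℝ, B).prod 𝓘(ℝ, F)) (𝓘(ℝ, B).prod 𝓘(ℝ, F)).tangent ∞ S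
  proj_eq : ∀ u, (S u).proj = u

/-- Semisprays: smooth `S : E → TE` with `τ_E ∘ S = id` and `Tπ ∘ S = ρ`. -/
structure IsSemispray (A : BanachLieAlgebroid B F E)
    (S : TotalSpace F E → TangentBundle (𝓘(ℝ, B).prod 𝓘(ℝ, F)) (TotalSpace F E)) : Prop
    extends IsVectorField B F S where
  tangent_eq : ∀ u,
    tangentMap (𝓘(ℝ, B).prod 𝓘(ℝ, F)) 𝓘(ℝ, B) (TotalSpace.proj : TotalSpace F E → M) (S u) = A.rho u

end Single

section Morphism

variable {B F : Type*} [NormedAddCommGroup B] [NormedSpace ℝ B]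
  [NormedAddCommGroup F] [NormedSpace ℝ F]
  {M : Type*} [TopologicalSpace M] [ChartedSpace B M] [IsManifold 𝓘(ℝ, B) ∞ M]
  {E : M → Type*} [∀ x, AddCommGroup (E x)] [∀ x, Module ℝ (E x)] [∀ x, TopologicalSpace (E x)]
  [TopologicalSpace (TotalSpace F E)] [FiberBundle F E] [VectorBundle ℝ F E]
  [ContMDiffVectorBundle ∞ F E 𝓘(ℝ, B)]
  {B' F' : Type*} [NormedAddCommGroup B'] [NormedSpace ℝ B']
  [NormedAddCommGroup F'] [NormedSpace ℝ F']
  {M' : Type*} [TopologicalSpace M'] [ChartedSpace B' M'] [IsManifold 𝓘(ℝ, B') ∞ M']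
  {E' : M' → Type*} [∀ x, AddCommGroup (E' x)] [∀ x, Module ℝ (E' x)]
  [∀ x, TopologicalSpace (E' x)]
  [TopologicalSpace (TotalSpace F' E')] [FiberBundle F' E'] [VectorBundle ℝ F' E']
  [ContMDiffVectorBundle ∞ F' E' 𝓘(ℝ, B')]

/-- A vector bundle morphism `ψ : E → E'` over `f : M → M'` is a morphism of Lie algebroids if the
pull-back of smooth forms, `(ψ^* α)_x = α_{f x}(ψ_x ·, …, ψ_x ·)`, commutes with the exterior
derivatives in all degrees. -/
structure IsMorphism (A : BanachLieAlgebroid B F E) (A' : BanachLieAlgebroid B' F' E') (f : M → M')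
    (ψ : ∀ x : M, E x →L[ℝ] E' (f x)) : Prop where
  contMDiff_base : ContMDiff 𝓘(ℝ, B) 𝓘(ℝ, B') ∞ f
  contMDiff_total : ContMDiff (𝓘(ℝ, B).prod 𝓘(ℝ, F)) (𝓘(ℝ, B').prod 𝓘(ℝ, F')) ∞
    (fun u : TotalSpace F E ↦ (⟨f u.proj, ψ u.proj u.2⟩ : TotalSpace F' E'))
  pullback_extDeriv : ∀ (q : ℕ) (α : ∀ x : M', E' x [⋀^Fin q]→L[ℝ] ℝ)
    (β : ∀ x : M', E' x [⋀^Fin (q + 1)]→L[ℝ] ℝ),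
    IsSmoothForm B' F' α → IsSmoothForm B' F' β → A'.IsExtDeriv α β →
      A.IsExtDeriv (fun x ↦ (α (f x)).compContinuousLinearMap (ψ x))
        (fun x ↦ (β (f x)).compContinuousLinearMap (ψ x))

end Morphism

end BanachLieAlgebroid

/-! ### Curves in topological vector spaces -/

/-- A curve `g` in a topological vector space is smooth on a set `J` of times if all its iterated
derivatives (limits of difference quotients, within `J`) exist on `J`. -/
def IsSmoothCurveIn {V : Type*} [AddCommGroup V] [Module ℝ V] [TopologicalSpace V]
    (g : ℝ → V) (J : Set ℝ) : Prop :=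
  ∃ G : ℕ → ℝ → V, (∀ t ∈ J, G 0 t = g t) ∧
    ∀ n, ∀ t ∈ J, Tendsto (slope (G n) t) (𝓝[J \ {t}] t) (𝓝 (G (n + 1) t))

/-! ### Projective systems of Banach manifolds and their limits -/

/-- A projective sequence of Banach manifolds `(M_i, δ_i^j)` with smooth transition maps, together
with a projective sequence of continuous linear maps between the Banach spaces `B_i` on which they
are modelled. -/
structure ManifoldSystem {B : ℕ → Type*} [∀ i, NormedAddCommGroup (B i)]
    [∀ i, NormedSpace ℝ (B i)] {H : ℕ → Type*} [∀ i, TopologicalSpace (H i)]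
    (I : ∀ i, ModelWithCorners ℝ (B i) (H i))
    (M : ℕ → Type*) [∀ i, TopologicalSpace (M i)] [∀ i, ChartedSpace (H i) (M i)] where
  map : ∀ ⦃i j : ℕ⦄, i ≤ j → M j → M i
  contMDiff_map : ∀ ⦃i j : ℕ⦄ (h : i ≤ j), ContMDiff (I j) (I i) ∞ (map h)
  map_refl : ∀ (i : ℕ) (x : M i), map le_rfl x = x
  map_map : ∀ ⦃i j k : ℕ⦄ (hij : i ≤ j) (hjk : j ≤ k) (x : M k),
    map hij (map hjk x) = map (hij.trans hjk) x
  modelMap : ∀ ⦃i j : ℕ⦄, i ≤ j → B j →L[ℝ] B i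
  modelMap_refl : ∀ (i : ℕ) (v : B i), modelMap le_rfl v = v
  modelMap_modelMap : ∀ ⦃i j k : ℕ⦄ (hij : i ≤ j) (hjk : j ≤ k) (v : B k),
    modelMap hij (modelMap hjk v) = modelMap (hij.trans hjk) v

namespace ManifoldSystem

section Limit

variable {B : ℕ → Type*} [∀ i, NormedAddCommGroup (B i)]
  [∀ i, NormedSpace ℝ (B i)] {H : ℕ → Type*} [∀ i, TopologicalSpace (H i)]
  {I : ∀ i, ModelWithCorners ℝ (B i) (H i)}
  {M : ℕ → Type*} [∀ i, TopologicalSpace (M i)] [∀ i, ChartedSpace (H i) (M i)]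

/-- The projective limit: the space of threads, with the topology induced by the product. -/
abbrev Lim (P : ManifoldSystem I M) : Type _ :=
  {x : ∀ i, M i // ∀ ⦃i j : ℕ⦄ (h : i ≤ j), P.map h (x j) = x i}

/-- The Fréchet space `lim B_i`, as a subspace of the product. -/
def modelLim (P : ManifoldSystem I M) : Submodule ℝ (∀ i, B i) where
  carrier := {v | ∀ ⦃i j : ℕ⦄ (h : i ≤ j), P.modelMap h (v j) = v i}
  add_mem' hv hw i j h := by simp [hv h, hw h]
  zero_mem' i j h := by simp
  smul_mem' a v hv i j h := by simp [hv h]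

/-- The tangent bundle of the limit, `lim TM_i`: threads for the tangent maps `Tδ_i^j`. -/
abbrev TLim (P : ManifoldSystem I M) : Type _ :=
  {w : ∀ i, TangentBundle (I i) (M i) //
    ∀ ⦃i j : ℕ⦄ (h : i ≤ j), tangentMap (I j) (I i) (P.map h) (w j) = w i}

/-- The projection `τ : lim TM_i → lim M_i`. -/
def tau (P : ManifoldSystem I M) (w : P.TLim) : P.Lim :=
  ⟨fun i ↦ (w.1 i).proj, fun _ _ h ↦ congrArg TotalSpace.proj (w.2 h)⟩

/-- A projective system of charts `φ_i : U_i → B_i`, compatible with the transition maps, such that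
`lim U_i` is open in `lim M_i`. -/
structure IsLimChart (P : ManifoldSystem I M) (φ : ∀ i, OpenPartialHomeomorph (M i) (H i)) :
    Prop where
  mem_maximalAtlas : ∀ i, φ i ∈ IsManifold.maximalAtlas (I i) ∞ (M i)
  mapsTo : ∀ ⦃i j : ℕ⦄ (h : i ≤ j), MapsTo (P.map h) (φ j).source (φ i).source
  coherent : ∀ ⦃i j : ℕ⦄ (h : i ≤ j), ∀ x ∈ (φ j).source,
    (φ i).extend (I i) (P.map h x) = P.modelMap h ((φ j).extend (I j) x)
  isOpen_source : IsOpen {x : P.Lim | ∀ i, x.1 i ∈ (φ i).source}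

/-- The system is strong if every thread lies in the domain of a projective system of charts. -/
def IsStrong (P : ManifoldSystem I M) : Prop :=
  ∀ x : P.Lim, ∃ φ : ∀ i, OpenPartialHomeomorph (M i) (H i),
    P.IsLimChart φ ∧ ∀ i, x.1 i ∈ (φ i).source

open Classical in
/-- The limit chart `φ = lim φ_i : lim U_i → lim B_i` (with value `0` outside `lim U_i`). -/
def limChart (P : ManifoldSystem I M) {φ : ∀ i, OpenPartialHomeomorph (M i) (H i)}
    (hφ : P.IsLimChart φ) (x : P.Lim) : P.modelLim :=
  if hx : ∀ i, x.1 i ∈ (φ i).source then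
    ⟨fun i ↦ (φ i).extend (I i) (x.1 i), fun i j h ↦ by
      rw [← hφ.coherent h _ (hx j), x.2 h]⟩
  else 0

/-- Smooth curves in the Fréchet manifold `lim M_i`, on a set `J` of times: locally, the curve lies
in the domain of a limit chart and is smooth in this chart. -/
def IsSmoothCurveOn (P : ManifoldSystem I M) (c : ℝ → P.Lim) (J : Set ℝ) : Prop :=
  ∀ t₀ ∈ J, ∃ (φ : ∀ i, OpenPartialHomeomorph (M i) (H i)) (hφ : P.IsLimChart φ) (O : Set ℝ),
    IsOpen O ∧ t₀ ∈ O ∧ (∀ t ∈ J ∩ O, ∀ i, (c t).1 i ∈ (φ i).source) ∧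
    IsSmoothCurveIn (fun t ↦ P.limChart hφ (c t)) (J ∩ O)

/-- The limit `(u_0, u_1, …) ↦ (S_0(u_0), S_1(u_1), …)` of vector fields `S_i` on `M_i` with
`Tδ_i^j ∘ S_j = S_i ∘ δ_i^j`. -/
def limField (P : ManifoldSystem I M) (S : ∀ i, M i → TangentBundle (I i) (M i))
    (hS : ∀ ⦃i j : ℕ⦄ (h : i ≤ j) (u : M j),
      tangentMap (I j) (I i) (P.map h) (S j u) = S i (P.map h u)) (u : P.Lim) : P.TLim :=
  ⟨fun i ↦ S i (u.1 i), fun i j h ↦ by rw [hS h, u.2 h]⟩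

theorem mfderiv_chart_coherent (P : ManifoldSystem I M)
    {φ : ∀ i, OpenPartialHomeomorph (M i) (H i)} (hφ : P.IsLimChart φ) (w : P.TLim)
    (hw : ∀ i, (w.1 i).proj ∈ (φ i).source) ⦃i j : ℕ⦄ (h : i ≤ j) :
    P.modelMap h (mfderiv (I j) 𝓘(ℝ, B j) ((φ j).extend (I j)) (w.1 j).proj (w.1 j).2) =
      (mfderiv (I i) 𝓘(ℝ, B i) ((φ i).extend (I i)) (w.1 i).proj (w.1 i).2 : B i) := by
  have hd : ∀ k, ∀ x ∈ (φ k).source,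
      MDifferentiableAt (I k) 𝓘(ℝ, B k) ((φ k).extend (I k)) x := fun k x hx ↦
    ((OpenPartialHomeomorph.contMDiffOn_extend (hφ.mem_maximalAtlas k) x hx).contMDiffAt
      ((φ k).open_source.mem_nhds hx)).mdifferentiableAt (by simp)
  rw [← w.2 h]
  have h1 : mfderiv (I j) 𝓘(ℝ, B i) ((φ i).extend (I i) ∘ P.map h) (w.1 j).proj =
      mfderiv (I j) 𝓘(ℝ, B i) (P.modelMap h ∘ (φ j).extend (I j)) (w.1 j).proj := by
    apply Filter.EventuallyEq.mfderiv_eq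
    filter_upwards [(φ j).open_source.mem_nhds (hw j)] with x hx
    exact hφ.coherent h x hx
  rw [mfderiv_comp (I' := I i) _ (hd i _ (hφ.mapsTo h (hw j)))
      ((P.contMDiff_map h).mdifferentiableAt (by simp)),
    mfderiv_comp (I' := 𝓘(ℝ, B j)) _ (P.modelMap h).mdifferentiableAt (hd j _ (hw j)),
    ContinuousLinearMap.mfderiv_eq] at h1
  exact (DFunLike.congr_fun h1 (w.1 j).2).symm

open Classical in
/-- The linear part `lim dφ_i` of the chart `Tφ : TU → lim B_i × lim B_i` of the tangent bundle that
is induced by the limit chart `φ` (with value `0` outside its domain). -/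
def limChartDeriv (P : ManifoldSystem I M) {φ : ∀ i, OpenPartialHomeomorph (M i) (H i)}
    (hφ : P.IsLimChart φ) (w : P.TLim) : P.modelLim :=
  if hw : ∀ i, (w.1 i).proj ∈ (φ i).source then
    ⟨fun i ↦ mfderiv (I i) 𝓘(ℝ, B i) ((φ i).extend (I i)) (w.1 i).proj (w.1 i).2,
      fun _ _ h ↦ P.mfderiv_chart_coherent hφ w hw h⟩
  else 0

/-- `c'(t) = w` for a curve `c` in the Fréchet manifold `lim M_i` (derivative within `J`): `w` is a
tangent vector at `c t`, the curve is continuous at `t`, and in a limit chart `φ` at `c t` the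
derivative of `φ ∘ c` at `t`, in the Fréchet space `lim B_i`, is the vector that represents `w`. -/
def HasVelocityWithinAt (P : ManifoldSystem I M) (c : ℝ → P.Lim) (J : Set ℝ) (t : ℝ)
    (w : P.TLim) : Prop :=
  P.tau w = c t ∧ ContinuousWithinAt c J t ∧
    ∃ (φ : ∀ i, OpenPartialHomeomorph (M i) (H i)) (hφ : P.IsLimChart φ),
      (∀ i, (c t).1 i ∈ (φ i).source) ∧
      Tendsto (slope (fun s ↦ P.limChart hφ (c s)) t) (𝓝[J \ {t}] t) (𝓝 (P.limChartDeriv hφ w))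

/-- Smooth curves in the tangent bundle of `lim M_i`: they are smooth in the charts `Tφ`. -/
def IsSmoothTangentCurveOn (P : ManifoldSystem I M) (w : ℝ → P.TLim) (J : Set ℝ) : Prop :=
  ∀ t₀ ∈ J, ∃ (φ : ∀ i, OpenPartialHomeomorph (M i) (H i)) (hφ : P.IsLimChart φ) (O : Set ℝ),
    IsOpen O ∧ t₀ ∈ O ∧ (∀ t ∈ J ∩ O, ∀ i, ((w t).1 i).proj ∈ (φ i).source) ∧
    IsSmoothCurveIn (fun t ↦ (P.limChart hφ (P.tau (w t)), P.limChartDeriv hφ (w t))) (J ∩ O)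

/-- Smooth vector fields on `lim M_i`: sections `S` of the tangent bundle that are smooth in the
sense of the convenient calculus, that is, map smooth curves to smooth curves. -/
structure IsVectorField (P : ManifoldSystem I M) (S : P.Lim → P.TLim) : Prop where
  smooth : ∀ c : ℝ → P.Lim, P.IsSmoothCurveOn c univ → P.IsSmoothTangentCurveOn (S ∘ c) univ
  tau_eq : ∀ u, P.tau (S u) = u

/-- Integral curves of a vector field on `lim M_i`: smooth curves with `c' = S(c)`. -/
def IsIntegralCurveOn (P : ManifoldSystem I M) (S : P.Lim → P.TLim) (c : ℝ → P.Lim)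
    (J : Set ℝ) : Prop :=
  P.IsSmoothCurveOn c J ∧ ∀ t ∈ J, P.HasVelocityWithinAt c J t (S (c t))

end Limit

end ManifoldSystem

/-! ### Strong projective systems of Banach Lie algebroids -/

/-- A strong projective system of Banach Lie algebroids `(E_i, π_i, M_i, ρ_i)`. -/
structure StrongAlgebroidSystem {B F : ℕ → Type*}
    [∀ i, NormedAddCommGroup (B i)] [∀ i, NormedSpace ℝ (B i)]
    [∀ i, NormedAddCommGroup (F i)] [∀ i, NormedSpace ℝ (F i)]
    {M : ℕ → Type*} [∀ i, TopologicalSpace (M i)] [∀ i, ChartedSpace (B i) (M i)]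
    [∀ i, IsManifold 𝓘(ℝ, B i) ∞ (M i)]
    {E : ∀ i, M i → Type*} [∀ i x, AddCommGroup (E i x)] [∀ i x, Module ℝ (E i x)]
    [∀ i x, TopologicalSpace (E i x)] [∀ i, TopologicalSpace (TotalSpace (F i) (E i))]
    [∀ i, FiberBundle (F i) (E i)] [∀ i, VectorBundle ℝ (F i) (E i)]
    [∀ i, ContMDiffVectorBundle ∞ (F i) (E i) 𝓘(ℝ, B i)]
    (A : ∀ i, BanachLieAlgebroid (B i) (F i) (E i)) where
  /-- The base manifolds `(M_i, δ_i^j)`. -/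
  base : ManifoldSystem (fun i ↦ 𝓘(ℝ, B i)) M
  isStrong_base : base.IsStrong
  /-- The linear maps between fibres that make up `f_i^j : E_j → E_i`. -/
  fiberMap : ∀ ⦃i j : ℕ⦄ (h : i ≤ j) (x : M j), E j x →L[ℝ] E i (base.map h x)
  fiberMap_refl : ∀ (i : ℕ) (u : TotalSpace (F i) (E i)),
    (⟨base.map le_rfl u.proj, fiberMap le_rfl u.proj u.2⟩ : TotalSpace (F i) (E i)) = u
  fiberMap_fiberMap : ∀ ⦃i j k : ℕ⦄ (hij : i ≤ j) (hjk : j ≤ k) (u : TotalSpace (F k) (E k)),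
    (⟨base.map hij (base.map hjk u.proj),
      fiberMap hij (base.map hjk u.proj) (fiberMap hjk u.proj u.2)⟩ : TotalSpace (F i) (E i)) =
      ⟨base.map (hij.trans hjk) u.proj, fiberMap (hij.trans hjk) u.proj u.2⟩
  /-- The maps `λ_i^j` between the typical fibres. -/
  typicalMap : ∀ ⦃i j : ℕ⦄, i ≤ j → F j →L[ℝ] F i
  typicalMap_refl : ∀ (i : ℕ) (v : F i), typicalMap le_rfl v = v
  typicalMap_typicalMap : ∀ ⦃i j k : ℕ⦄ (hij : i ≤ j) (hjk : j ≤ k) (v : F k),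
    typicalMap hij (typicalMap hjk v) = typicalMap (hij.trans hjk) v
  /-- Around every thread there is a projective system of smooth linear trivializations `τ_i` over
  open sets `U_i` with `lim U_i` open and `(δ_i^j × λ_i^j) ∘ τ_j = τ_i ∘ f_i^j`. -/
  exists_trivializations : ∀ x : base.Lim,
    ∃ e : ∀ i, Trivialization (F i) (TotalSpace.proj : TotalSpace (F i) (E i) → M i),
      (∀ i, (e i).IsLinear ℝ) ∧
      (∀ i, ContMDiffOn (𝓘(ℝ, B i).prod 𝓘(ℝ, F i)) (𝓘(ℝ, B i).prod 𝓘(ℝ, F i)) ∞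
        (e i) (e i).source) ∧
      (∀ i, ContMDiffOn (𝓘(ℝ, B i).prod 𝓘(ℝ, F i)) (𝓘(ℝ, B i).prod 𝓘(ℝ, F i)) ∞
        (e i).toOpenPartialHomeomorph.symm (e i).target) ∧
      (∀ i, x.1 i ∈ (e i).baseSet) ∧
      IsOpen {y : base.Lim | ∀ i, y.1 i ∈ (e i).baseSet} ∧
      (∀ ⦃i j : ℕ⦄ (h : i ≤ j), MapsTo (base.map h) (e j).baseSet (e i).baseSet) ∧
      (∀ ⦃i j : ℕ⦄ (h : i ≤ j) (u : TotalSpace (F j) (E j)), u.proj ∈ (e j).baseSet →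
        e i ⟨base.map h u.proj, fiberMap h u.proj u.2⟩ =
          (base.map h (e j u).1, typicalMap h (e j u).2))
  /-- `ρ_i ∘ f_i^j = Tδ_i^j ∘ ρ_j`. -/
  anchor_compat : ∀ ⦃i j : ℕ⦄ (h : i ≤ j) (x : M j) (v : E j x),
    (A i).anchor (base.map h x) (fiberMap h x v) =
      mfderiv 𝓘(ℝ, B j) 𝓘(ℝ, B i) (base.map h) x ((A j).anchor x v)
  /-- `f_i^j` is a morphism of Lie algebroids. -/
  isMorphism : ∀ ⦃i j : ℕ⦄ (h : i ≤ j), (A j).IsMorphism (A i) (base.map h) (fiberMap h)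

namespace StrongAlgebroidSystem

section

variable {B F : ℕ → Type*}
  [∀ i, NormedAddCommGroup (B i)] [∀ i, NormedSpace ℝ (B i)]
  [∀ i, NormedAddCommGroup (F i)] [∀ i, NormedSpace ℝ (F i)]
  {M : ℕ → Type*} [∀ i, TopologicalSpace (M i)] [∀ i, ChartedSpace (B i) (M i)]
  [∀ i, IsManifold 𝓘(ℝ, B i) ∞ (M i)]
  {E : ∀ i, M i → Type*} [∀ i x, AddCommGroup (E i x)] [∀ i x, Module ℝ (E i x)]
  [∀ i x, TopologicalSpace (E i x)] [∀ i, TopologicalSpace (TotalSpace (F i) (E i))]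
  [∀ i, FiberBundle (F i) (E i)] [∀ i, VectorBundle ℝ (F i) (E i)]
  [∀ i, ContMDiffVectorBundle ∞ (F i) (E i) 𝓘(ℝ, B i)]
  {A : ∀ i, BanachLieAlgebroid (B i) (F i) (E i)}

/-- The projective system `(E_i, f_i^j)` of the total spaces, modelled on `B_i × F_i`. -/
def total (P : StrongAlgebroidSystem A) :
    ManifoldSystem (fun i ↦ 𝓘(ℝ, B i).prod 𝓘(ℝ, F i)) (fun i ↦ TotalSpace (F i) (E i)) where
  map _ _ h u := ⟨P.base.map h u.proj, P.fiberMap h u.proj u.2⟩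
  contMDiff_map _ _ h := (P.isMorphism h).contMDiff_total
  map_refl := P.fiberMap_refl
  map_map := P.fiberMap_fiberMap
  modelMap _ _ h := (P.base.modelMap h).prodMap (P.typicalMap h)
  modelMap_refl i v := Prod.ext (P.base.modelMap_refl i v.1) (P.typicalMap_refl i v.2)
  modelMap_modelMap _ _ _ hij hjk v :=
    Prod.ext (P.base.modelMap_modelMap hij hjk v.1) (P.typicalMap_typicalMap hij hjk v.2)

/-- `π = lim π_i : lim E_i → lim M_i`. -/
def proj (P : StrongAlgebroidSystem A) (u : P.total.Lim) : P.base.Lim :=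
  ⟨fun i ↦ (u.1 i).proj, fun _ _ h ↦ congrArg TotalSpace.proj (u.2 h)⟩

/-- `ρ = lim ρ_i : lim E_i → lim TM_i`. -/
def rho (P : StrongAlgebroidSystem A) (u : P.total.Lim) : P.base.TLim :=
  ⟨fun i ↦ (A i).rho (u.1 i), fun i j h ↦ by
    beta_reduce
    rw [← u.2 h]
    exact congrArg (fun v ↦ (⟨P.base.map h (u.1 j).proj, v⟩ : TangentBundle 𝓘(ℝ, B i) (M i)))
      (P.anchor_compat h (u.1 j).proj (u.1 j).2).symm⟩

/-- `Tπ = lim Tπ_i : lim TE_i → lim TM_i`. -/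
def tangentProj (P : StrongAlgebroidSystem A) (w : P.total.TLim) : P.base.TLim :=
  ⟨fun i ↦ tangentMap (𝓘(ℝ, B i).prod 𝓘(ℝ, F i)) 𝓘(ℝ, B i)
      (TotalSpace.proj : TotalSpace (F i) (E i) → M i) (w.1 i), fun i j h ↦ by
    have hj : MDifferentiable (𝓘(ℝ, B j).prod 𝓘(ℝ, F j)) 𝓘(ℝ, B j)
        (TotalSpace.proj : TotalSpace (F j) (E j) → M j) :=
      (contMDiff_proj (E j) (n := ∞)).mdifferentiable (by simp)
    have hi : MDifferentiable (𝓘(ℝ, B i).prod 𝓘(ℝ, F i)) 𝓘(ℝ, B i)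
        (TotalSpace.proj : TotalSpace (F i) (E i) → M i) :=
      (contMDiff_proj (E i) (n := ∞)).mdifferentiable (by simp)
    have h1 := tangentMap_comp ((P.base.contMDiff_map h).mdifferentiable (by simp)) hj
    have h2 := tangentMap_comp hi ((P.total.contMDiff_map h).mdifferentiable (by simp))
    beta_reduce
    rw [← w.2 h]
    exact (congrFun h1 (w.1 j)).symm.trans (congrFun h2 (w.1 j))⟩

/-- Semisprays on the Fréchet Lie algebroid `E = lim E_i`: smooth vector fields `S : E → TE`
(in particular `τ_E ∘ S = id`) with `Tπ ∘ S = ρ`. -/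
structure IsSemispray (P : StrongAlgebroidSystem A) (S : P.total.Lim → P.total.TLim) : Prop
    extends P.total.IsVectorField S where
  tangent_eq : ∀ u, P.tangentProj (S u) = P.rho u

/-- Admissible curves in `E = lim E_i`, on a set `J` of times: `(π ∘ c)' = ρ(c)` on `J`. -/
def IsAdmissibleOn (P : StrongAlgebroidSystem A) (c : ℝ → P.total.Lim) (J : Set ℝ) : Prop :=
  ∀ t ∈ J, P.base.HasVelocityWithinAt (fun s ↦ P.proj (c s)) J t (P.rho (c t))

end

end StrongAlgebroidSystem

end

/-! ### Smooth curves in topological vector spaces -/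

section Curves

/-! Both `lim M_i` and `lim B_i` carry the topology induced by a product, so limits of difference
quotients can be tested in each component. A curve in a strong limit therefore has velocity `w`
exactly when each component has velocity `w_i` (`HasVelocityWithinAt.hasTangentWithinAt`,
`IsStrong.hasVelocityWithinAt`), and it is smooth when its components are
(`IsStrong.isSmoothCurveOn`). Openness of `lim U_i` is essential: it gives one neighbourhood of `t`
on which the curve stays in all the `U_i` at once. The total spaces are again strong
(`isStrong_total`), so all this applies to `E` as well as to `M`.

Statements (1) and (2) then reduce to their counterparts at each level `i`. For (3), the chain rule
gives `(π ∘ c)' = Tπ(c') = Tπ(S(c))` along an integral curve, while admissibility says `(π ∘ c)' =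
ρ(c)`. Velocities within a nondegenerate interval are unique, so along `c` the two conditions agree.
This controls only points on integral curves. The final equivalence therefore needs either such a
curve through every point or semisprays at every level, in which case both of its sides hold. -/

theorem IsSmoothCurveIn.clm_comp {V W : Type*} [AddCommGroup V] [Module ℝ V] [TopologicalSpace V]
    [AddCommGroup W] [Module ℝ W] [TopologicalSpace W] {g : ℝ → V} {J : Set ℝ}
    (hg : IsSmoothCurveIn g J) (L : V →L[ℝ] W) : IsSmoothCurveIn (fun t ↦ L (g t)) J := by
  obtain ⟨G, h0, hG⟩ := hg
  refine ⟨fun n t ↦ L (G n t), fun t ht ↦ congrArg L (h0 t ht), fun n t ht ↦ ?_⟩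
  refine ((L.continuous.tendsto _).comp (hG n t ht)).congr fun s ↦ ?_
  simp [slope_def_module]

theorem IsSmoothCurveIn.prodMk {V W : Type*} [AddCommGroup V] [Module ℝ V] [TopologicalSpace V]
    [AddCommGroup W] [Module ℝ W] [TopologicalSpace W] {g : ℝ → V} {k : ℝ → W} {J : Set ℝ}
    (hg : IsSmoothCurveIn g J) (hk : IsSmoothCurveIn k J) :
    IsSmoothCurveIn (fun t ↦ (g t, k t)) J := by
  obtain ⟨G, hG0, hG⟩ := hg
  obtain ⟨K, hK0, hK⟩ := hk
  refine ⟨fun n t ↦ (G n t, K n t), fun t ht ↦ Prod.ext (hG0 t ht) (hK0 t ht), fun n t ht ↦ ?_⟩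
  refine ((hG n t ht).prodMk_nhds (hK n t ht)).congr fun s ↦ ?_
  simp [slope_def_module]

/-- The derivative of `G n` within `J` is `G (n + 1)`, so induction on the order `m` works for all
members of the sequence simultaneously. Unique differentiability identifies `derivWithin` with the
given limits. -/
theorem IsSmoothCurveIn.contDiffOn {V : Type*} [NormedAddCommGroup V] [NormedSpace ℝ V]
    {g : ℝ → V} {J : Set ℝ} (hg : IsSmoothCurveIn g J) (hJ : UniqueDiffOn ℝ J) :
    ContDiffOn ℝ ∞ g J := by
  obtain ⟨G, h0, hG⟩ := hg
  have hd : ∀ n, ∀ t ∈ J, HasDerivWithinAt (G n) (G (n + 1) t) J t := fun n t ht ↦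
    hasDerivWithinAt_iff_tendsto_slope.2 (hG n t ht)
  have key : ∀ m n : ℕ, ContDiffOn ℝ m (G n) J := by
    intro m
    induction m with
    | zero =>
      intro n
      exact contDiffOn_zero.2 fun t ht ↦ (hd n t ht).continuousWithinAt
    | succ m ih =>
      intro n
      have : ContDiffOn ℝ ((m : ℕ∞ω) + 1) (G n) J :=
        (contDiffOn_succ_iff_derivWithin hJ).2
          ⟨fun t ht ↦ (hd n t ht).differentiableWithinAt, fun h ↦ by simp at h,
            (ih (n + 1)).congr fun t ht ↦ (hd n t ht).derivWithin (hJ t ht)⟩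
      exact_mod_cast this
  exact (contDiffOn_infty.2 fun m ↦ key m 0).congr fun t ht ↦ (h0 t ht).symm

theorem ContDiffOn.hasDerivWithinAt_iteratedDerivWithin {V : Type*} [NormedAddCommGroup V]
    [NormedSpace ℝ V] {g : ℝ → V} {J : Set ℝ} (hg : ContDiffOn ℝ ∞ g J) (hJ : UniqueDiffOn ℝ J)
    (n : ℕ) {t : ℝ} (ht : t ∈ J) :
    HasDerivWithinAt (iteratedDerivWithin n g J) (iteratedDerivWithin (n + 1) g J t) J t := by
  rw [iteratedDerivWithin_succ]
  exact (hg.differentiableOn_iteratedDerivWithin (by exact_mod_cast ENat.natCast_lt_top n) hJ t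
    ht).hasDerivWithinAt

/-- A continuous linear map commutes with differentiation, and derivatives within `J` are unique.
With the transition maps `P.modelMap` as `L`, this makes the componentwise derivatives of a curve in
`lim B_i` into threads. -/
theorem ContDiffOn.clm_iteratedDerivWithin {V W : Type*} [NormedAddCommGroup V]
    [NormedSpace ℝ V] [NormedAddCommGroup W] [NormedSpace ℝ W] {g : ℝ → V} {k : ℝ → W} {J : Set ℝ}
    (hg : ContDiffOn ℝ ∞ g J) (hk : ContDiffOn ℝ ∞ k J) (hJ : UniqueDiffOn ℝ J) (L : V →L[ℝ] W)
    (h : ∀ t ∈ J, L (g t) = k t) (n : ℕ) :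
    ∀ t ∈ J, L (iteratedDerivWithin n g J t) = iteratedDerivWithin n k J t := by
  induction n with
  | zero => simpa using h
  | succ n ih =>
    intro t ht
    have h1 := L.hasFDerivAt.comp_hasDerivWithinAt t
      (hg.hasDerivWithinAt_iteratedDerivWithin hJ n ht)
    have h2 := hk.hasDerivWithinAt_iteratedDerivWithin hJ n ht
    exact (hJ t ht).eq_deriv _ (h1.congr (fun s hs ↦ (ih s hs).symm) (ih t ht).symm) h2

theorem Set.OrdConnected.uniqueDiffOn_real {J : Set ℝ} (hJ : J.OrdConnected)
    (hn : J.Nontrivial) : UniqueDiffOn ℝ J :=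
  uniqueDiffOn_convex hJ.convex (hJ.convex.nontrivial_iff_nonempty_interior.1 hn)

end Curves

/-! ### Velocities of curves in Banach manifolds -/

section Velocity

variable {B : Type*} [NormedAddCommGroup B] [NormedSpace ℝ B] {H : Type*} [TopologicalSpace H]
  {I : ModelWithCorners ℝ B H} {M : Type*} [TopologicalSpace M] [ChartedSpace H M]
  {B' : Type*} [NormedAddCommGroup B'] [NormedSpace ℝ B'] {H' : Type*} [TopologicalSpace H']
  {I' : ModelWithCorners ℝ B' H'} {M' : Type*} [TopologicalSpace M'] [ChartedSpace H' M']

variable (I) in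
/-- The curve `c` in the manifold `M` has velocity `w ∈ TM` at time `t`, within `J`. -/
def HasTangentWithinAt (c : ℝ → M) (J : Set ℝ) (t : ℝ) (w : TangentBundle I M) : Prop :=
  w.proj = c t ∧ ∃ D : ℝ →L[ℝ] B, HasMFDerivWithinAt 𝓘(ℝ) I c J t D ∧ D 1 = (w.2 : B)

namespace HasTangentWithinAt

variable {c : ℝ → M} {J : Set ℝ} {t : ℝ} {w w' : TangentBundle I M}

theorem continuousWithinAt (h : HasTangentWithinAt I c J t w) : ContinuousWithinAt c J t :=
  h.2.choose_spec.1.continuousWithinAt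

theorem congr {c' : ℝ → M} (h : HasTangentWithinAt I c J t w) (ht : t ∈ J)
    (hc : ∀ s ∈ J, c' s = c s) : HasTangentWithinAt I c' J t w := by
  obtain ⟨h1, D, hD, hD1⟩ := h
  exact ⟨h1.trans (hc t ht).symm, D, hD.congr_of_eventuallyEq
    (eventually_nhdsWithin_of_forall hc) (hc t ht), hD1⟩

theorem comp_tangentMap (h : HasTangentWithinAt I c J t w) {f : M → M'}
    (hf : MDifferentiableAt I I' f (c t)) :
    HasTangentWithinAt I' (f ∘ c) J t (tangentMap I I' f w) := by
  -- The base point of `w` equals `c t` only propositionally; substituting it puts `v` in the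
  -- tangent space at `c t`, where the derivatives live.
  obtain ⟨x, v⟩ := w
  obtain ⟨h1, D, hD, hD1⟩ := h
  change x = c t at h1
  subst h1
  refine ⟨rfl, _, hf.hasMFDerivAt.comp_hasMFDerivWithinAt t hD, ?_⟩
  exact congrArg (mfderiv I I' f (c t)) hD1

theorem eq (h : HasTangentWithinAt I c J t w) (h' : HasTangentWithinAt I c J t w')
    (hJ : UniqueDiffWithinAt ℝ J t) : w = w' := by
  obtain ⟨x, v⟩ := w
  obtain ⟨x', v'⟩ := w'
  obtain ⟨h1, D, hD, hD1⟩ := h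
  obtain ⟨h1', D', hD', hD1'⟩ := h'
  change x = c t at h1
  change x' = c t at h1'
  subst h1 h1'
  have h2 := UniqueMDiffWithinAt.eq hJ.uniqueMDiffWithinAt hD hD'
  exact congrArg (TotalSpace.mk (c t))
    (hD1.symm.trans ((DFunLike.congr_fun h2 (1 : ℝ)).trans hD1'))

/-- The velocity of a curve is read off in any chart of the maximal atlas. -/
theorem hasDerivWithinAt_extend {e : OpenPartialHomeomorph M H}
    (he : e ∈ IsManifold.maximalAtlas I ∞ M) (hx : c t ∈ e.source)
    (h : HasTangentWithinAt I c J t w) :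
    HasDerivWithinAt (e.extend I ∘ c) (mfderiv I 𝓘(ℝ, B) (e.extend I) w.proj w.2 : B) J t := by
  obtain ⟨-, D, hD, hD1⟩ := h.comp_tangentMap (f := e.extend I)
    ((e.contMDiffAt_extend he hx).mdifferentiableAt (by simp))
  have h2 : HasFDerivWithinAt (e.extend I ∘ c) D J t := hD.hasFDerivWithinAt
  have h3 := h2.hasDerivWithinAt
  have h4 : D 1 = (mfderiv I 𝓘(ℝ, B) (e.extend I) w.proj w.2 : B) := hD1
  exact h4 ▸ h3

/-- Near `t` the curve is `φ⁻¹ ∘ (φ ∘ c)`, so its velocity is `dφ⁻¹(dφ(w)) = w`. Continuity must be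
assumed, since `φ ∘ c` carries no information once `c` leaves the domain of `φ`. -/
theorem of_hasDerivWithinAt_extend {e : OpenPartialHomeomorph M H}
    (he : e ∈ IsManifold.maximalAtlas I ∞ M) (hx : c t ∈ e.source)
    (hw : w.proj = c t) (hc : ContinuousWithinAt c J t)
    (h : HasDerivWithinAt (e.extend I ∘ c)
      (mfderiv I 𝓘(ℝ, B) (e.extend I) w.proj w.2 : B) J t) :
    HasTangentWithinAt I c J t w := by
  obtain ⟨x, v⟩ := w
  change x = c t at hw
  subst hw
  have hs : e.source ∈ 𝓝 (c t) := e.open_source.mem_nhds hx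
  have hinv : ∀ y ∈ e.source, (e.extend I).symm (e.extend I y) = y := fun y hy ↦
    e.extend_left_inv hy
  have himg : ∀ y ∈ e.source, e.extend I y ∈ I '' e.target := fun y hy ↦
    ⟨e y, e.map_source hy, rfl⟩
  have hsymm := (contMDiffOn_extend_symm he _ (himg _ hx)).mdifferentiableWithinAt
    (by simp) |>.hasMFDerivWithinAt
  have hext := ((e.contMDiffAt_extend he hx).mdifferentiableAt (by simp)).hasMFDerivAt
  -- The derivative of `φ⁻¹ ∘ φ` is computed by the chain rule and as that of the identity; hence
  -- `dφ⁻¹ ∘ dφ = id` in `hinvd`.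
  have hid := HasMFDerivWithinAt.comp (c t) hsymm (hext.hasMFDerivWithinAt (s := e.source)) himg
  have hid' : HasMFDerivWithinAt I I ((e.extend I).symm ∘ e.extend I) e.source (c t)
      (ContinuousLinearMap.id ℝ (TangentSpace I (c t))) :=
    (hasMFDerivWithinAt_id (I := I) e.source (c t)).congr_of_eventuallyEq
      (eventually_nhdsWithin_of_forall hinv) (hinv _ hx)
  have hinvd := UniqueMDiffWithinAt.eq (e.open_source.uniqueMDiffWithinAt hx) hid hid'
  -- Times are restricted to those at which `c` lies in the chart domain. By continuity they form a
  -- neighbourhood of `t` within `J`, so the restriction is lifted afterwards.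
  have hcurve := HasMFDerivWithinAt.comp (g := (e.extend I).symm) (f := e.extend I ∘ c)
    (u := I '' e.target) t hsymm
    ((h.hasFDerivWithinAt.hasMFDerivWithinAt).mono (inter_subset_left (t := c ⁻¹' e.source)))
    fun s hs ↦ himg _ hs.2
  refine ⟨rfl, _, (hcurve.congr_of_eventuallyEq (f₁ := c)
    (eventually_nhdsWithin_of_forall fun s hs ↦ (hinv _ hs.2).symm)
    (hinv _ hx).symm).mono_of_mem_nhdsWithin (inter_mem self_mem_nhdsWithin (hc hs)), ?_⟩
  refine Eq.trans (congrArg (mfderivWithin 𝓘(ℝ, B) I (e.extend I).symm (I '' e.target)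
    (e.extend I (c t))) ?_) (DFunLike.congr_fun hinvd v)
  exact one_smul ℝ (mfderiv I 𝓘(ℝ, B) (e.extend I) (c t) v : B)

end HasTangentWithinAt

end Velocity

/-! ### Curves and vector fields on limits of Banach manifolds -/

namespace ManifoldSystem

variable {B : ℕ → Type*} [∀ i, NormedAddCommGroup (B i)]
  [∀ i, NormedSpace ℝ (B i)] {H : ℕ → Type*} [∀ i, TopologicalSpace (H i)]
  {I : ∀ i, ModelWithCorners ℝ (B i) (H i)}
  {M : ℕ → Type*} [∀ i, TopologicalSpace (M i)] [∀ i, ChartedSpace (H i) (M i)]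
  {P : ManifoldSystem I M}

/-- The canonical projection `lim B_i → B_i`. -/
def modelProj (P : ManifoldSystem I M) (i : ℕ) : P.modelLim →L[ℝ] B i :=
  (ContinuousLinearMap.proj i).comp P.modelLim.subtypeL

theorem limChart_apply {φ : ∀ i, OpenPartialHomeomorph (M i) (H i)} (hφ : P.IsLimChart φ)
    {x : P.Lim} (hx : ∀ i, x.1 i ∈ (φ i).source) (i : ℕ) :
    (P.limChart hφ x).1 i = (φ i).extend (I i) (x.1 i) := by
  rw [limChart, dif_pos hx]

theorem limChartDeriv_apply {φ : ∀ i, OpenPartialHomeomorph (M i) (H i)} (hφ : P.IsLimChart φ)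
    {w : P.TLim} (hw : ∀ i, (w.1 i).proj ∈ (φ i).source) (i : ℕ) :
    (P.limChartDeriv hφ w).1 i =
      (mfderiv (I i) 𝓘(ℝ, B i) ((φ i).extend (I i)) (w.1 i).proj (w.1 i).2 : B i) := by
  rw [limChartDeriv, dif_pos hw]

/-- A curve in `lim B_i` is smooth if its components are. -/
theorem isSmoothCurveIn_modelLim {g : ℝ → P.modelLim} {J : Set ℝ} (hJ : UniqueDiffOn ℝ J)
    (hg : ∀ i, ContDiffOn ℝ ∞ (fun t ↦ (g t).1 i) J) : IsSmoothCurveIn g J := by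
  classical
  have hmem : ∀ n, ∀ t ∈ J,
      (fun i ↦ iteratedDerivWithin n (fun t ↦ (g t).1 i) J t) ∈ P.modelLim := fun n t ht i j h ↦
    (hg j).clm_iteratedDerivWithin (hg i) hJ (P.modelMap h) (fun s _ ↦ (g s).2 h) n t ht
  -- Outside `J` the derivatives need not form a thread; the value `0` there is never used.
  let G : ℕ → ℝ → P.modelLim := fun n t ↦
    if ht : t ∈ J then ⟨_, hmem n t ht⟩ else 0
  have hG : ∀ n, ∀ t ∈ J, ∀ i, (G n t).1 i = iteratedDerivWithin n (fun t ↦ (g t).1 i) J t := by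
    intro n t ht i
    simp only [G, dif_pos ht]
  refine ⟨G, fun t ht ↦ Subtype.ext (funext fun i ↦ ?_), fun n t ht ↦ ?_⟩
  · rw [hG 0 t ht i, iteratedDerivWithin_zero]
  · rw [tendsto_subtype_rng, tendsto_pi_nhds]
    intro i
    rw [hG (n + 1) t ht i]
    refine (hasDerivWithinAt_iff_tendsto_slope.1
      ((hg i).hasDerivWithinAt_iteratedDerivWithin hJ n ht)).congr' ?_
    filter_upwards [self_mem_nhdsWithin] with s hs
    rw [slope_def_module, slope_def_module, ← hG n s hs.1 i, ← hG n t ht i]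
    rfl

theorem continuousWithinAt_lim_iff {c : ℝ → P.Lim} {J : Set ℝ} {t : ℝ} :
    ContinuousWithinAt c J t ↔ ∀ i, ContinuousWithinAt (fun s ↦ (c s).1 i) J t :=
  tendsto_subtype_rng.trans tendsto_pi_nhds

/-- The projection `lim B_i → B_i` is continuous and linear, so it carries difference quotients in
the limit chart to those of `φ_i ∘ c_i`. -/
theorem HasVelocityWithinAt.hasTangentWithinAt {c : ℝ → P.Lim} {J : Set ℝ} {t : ℝ} {w : P.TLim}
    (h : P.HasVelocityWithinAt c J t w) (i : ℕ) :
    HasTangentWithinAt (I i) (fun s ↦ (c s).1 i) J t (w.1 i) := by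
  obtain ⟨hw, hc, φ, hφ, hx, hlim⟩ := h
  have hwi : ∀ i, (w.1 i).proj = (c t).1 i := fun i ↦ congrFun (congrArg Subtype.val hw) i
  have hev : ∀ᶠ s in 𝓝[J] t, ∀ i, (c s).1 i ∈ (φ i).source :=
    hc.eventually (hφ.isOpen_source.mem_nhds hx)
  refine .of_hasDerivWithinAt_extend (hφ.mem_maximalAtlas i) (hx i) (hwi i)
    (continuousWithinAt_lim_iff.1 hc i) ?_
  refine hasDerivWithinAt_iff_tendsto_slope.2 ?_
  rw [← limChartDeriv_apply hφ (fun i ↦ (hwi i).symm ▸ hx i) i]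
  refine (((P.modelProj i).continuous.tendsto _).comp hlim).congr' ?_
  filter_upwards [hev.filter_mono (nhdsWithin_mono t sdiff_subset)] with s hs
  simp only [Function.comp, slope_def_module, ← limChart_apply hφ hs, ← limChart_apply hφ hx]
  rfl

/-- Strength provides charts around `c t` at all levels whose limit domain is open. For `s` near `t`
the limit chart thus has its true value rather than the default `0`, and convergence in `lim B_i` is
componentwise. -/
theorem IsStrong.hasVelocityWithinAt (hP : P.IsStrong) {c : ℝ → P.Lim} {J : Set ℝ} {t : ℝ}
    {w : P.TLim}
    (h : ∀ i, HasTangentWithinAt (I i) (fun s ↦ (c s).1 i) J t (w.1 i)) :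
    P.HasVelocityWithinAt c J t w := by
  have hc : ContinuousWithinAt c J t :=
    continuousWithinAt_lim_iff.2 fun i ↦ (h i).continuousWithinAt
  obtain ⟨φ, hφ, hx⟩ := hP (c t)
  have hev : ∀ᶠ s in 𝓝[J] t, ∀ i, (c s).1 i ∈ (φ i).source :=
    hc.eventually (hφ.isOpen_source.mem_nhds hx)
  refine ⟨Subtype.ext (funext fun i ↦ (h i).1), hc, φ, hφ, hx, ?_⟩
  rw [tendsto_subtype_rng, tendsto_pi_nhds]
  intro i
  rw [limChartDeriv_apply hφ (fun i ↦ (h i).1.symm ▸ hx i) i]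
  refine (hasDerivWithinAt_iff_tendsto_slope.1
    ((h i).hasDerivWithinAt_extend (hφ.mem_maximalAtlas i) (hx i))).congr' ?_
  filter_upwards [hev.filter_mono (nhdsWithin_mono t sdiff_subset)] with s hs
  simp only [Function.comp, slope_def_module, ← limChart_apply hφ hs, ← limChart_apply hφ hx]
  rfl

/-- In a strong system, a curve on an interval is smooth if its components are. -/
theorem IsStrong.isSmoothCurveOn (hP : P.IsStrong) {c : ℝ → P.Lim} {J : Set ℝ}
    (hJ : UniqueDiffOn ℝ J)
    (h : ∀ i, ContMDiffOn 𝓘(ℝ) (I i) ∞ (fun s ↦ (c s).1 i) J) : P.IsSmoothCurveOn c J := by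
  intro t₀ ht₀
  have hc : ContinuousOn c J := fun t ht ↦
    continuousWithinAt_lim_iff.2 fun i ↦ (h i t ht).continuousWithinAt
  obtain ⟨φ, hφ, hx⟩ := hP (c t₀)
  -- `J ∩ O` is the set of times in `J` at which the curve lies in `lim U_i`; a single `O` serves
  -- all levels.
  obtain ⟨O, hO, hO'⟩ := continuousOn_iff'.1 hc _ hφ.isOpen_source
  have hmem : ∀ t, t ∈ J → (t ∈ O ↔ ∀ i, (c t).1 i ∈ (φ i).source) := fun t ht ↦ by
    have := Set.ext_iff.1 hO' t
    simp only [mem_inter_iff, ht, and_true] at this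
    exact this.symm
  have hsrc : ∀ t ∈ J ∩ O, ∀ i, (c t).1 i ∈ (φ i).source := fun t ht ↦ (hmem t ht.1).1 ht.2
  refine ⟨φ, hφ, O, hO, (hmem t₀ ht₀).2 hx, hsrc, isSmoothCurveIn_modelLim (hJ.inter hO) fun i ↦ ?_⟩
  have h1 : ContMDiffOn 𝓘(ℝ) 𝓘(ℝ, B i) ∞ ((φ i).extend (I i) ∘ fun s ↦ (c s).1 i) (J ∩ O) :=
    ((φ i).contMDiffOn_extend (hφ.mem_maximalAtlas i)).comp ((h i).mono inter_subset_left)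
      fun t ht ↦ hsrc t ht i
  exact h1.contDiffOn.congr fun t ht ↦ limChart_apply hφ (hsrc t ht) i

/-- The components of a curve that is smooth in a limit chart are smooth. -/
theorem contMDiffOn_of_isSmoothCurveIn {φ : ∀ i, OpenPartialHomeomorph (M i) (H i)}
    (hφ : P.IsLimChart φ) {c : ℝ → P.Lim} {J : Set ℝ} (hJ : UniqueDiffOn ℝ J)
    (hc : ∀ t ∈ J, ∀ i, (c t).1 i ∈ (φ i).source)
    (h : IsSmoothCurveIn (fun t ↦ P.limChart hφ (c t)) J) (i : ℕ) :
    ContMDiffOn 𝓘(ℝ) (I i) ∞ (fun t ↦ (c t).1 i) J := by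
  have h1 : ContDiffOn ℝ ∞ (fun t ↦ (φ i).extend (I i) ((c t).1 i)) J :=
    ((h.clm_comp (P.modelProj i)).contDiffOn hJ).congr fun t ht ↦
      (limChart_apply hφ (hc t ht) i).symm
  refine ((contMDiffOn_extend_symm (hφ.mem_maximalAtlas i)).comp h1.contMDiffOn
    fun t ht ↦ ⟨_, (φ i).map_source (hc t ht i), rfl⟩).congr fun t ht ↦ ?_
  exact ((φ i).extend_left_inv (hc t ht i)).symm

/-- The linear part of the chart of the tangent bundle induced by a chart of the maximal atlas. -/
theorem contMDiffOn_mfderiv_extend {B : Type*} [NormedAddCommGroup B] [NormedSpace ℝ B]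
    {H : Type*} [TopologicalSpace H] {I : ModelWithCorners ℝ B H} {M : Type*} [TopologicalSpace M]
    [ChartedSpace H M] [IsManifold I ∞ M] {e : OpenPartialHomeomorph M H}
    (he : e ∈ IsManifold.maximalAtlas I ∞ M) :
    ContMDiffOn I.tangent 𝓘(ℝ, B) ∞
      (fun w : TangentBundle I M ↦ (mfderiv I 𝓘(ℝ, B) (e.extend I) w.proj w.2 : B))
      (TotalSpace.proj ⁻¹' e.source) := by
  have : IsManifold I 1 M := .of_le (n := ∞) (by simp)
  -- The linear part of `Tφ` is the fibre component of the tangent map of `φ`, and the tangent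
  -- bundle of the model space is trivial.
  have h1 := (e.contMDiffOn_extend he).contMDiffOn_tangentMapWithin (m := ∞) (by simp)
    e.open_source.uniqueMDiffOn
  refine ((contMDiff_snd_tangentBundle_modelSpace B 𝓘(ℝ, B)).comp_contMDiffOn h1).congr
    fun w hw ↦ ?_
  change _ = mfderivWithin I 𝓘(ℝ, B) (e.extend I) e.source w.proj w.2
  rw [mfderivWithin_of_isOpen e.open_source hw]

/-- Limits of smooth vector fields are smooth vector fields. -/
theorem isVectorField_limField [∀ i, IsManifold (I i) ∞ (M i)]
    (S : ∀ i, M i → TangentBundle (I i) (M i))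
    (hS : ∀ ⦃i j : ℕ⦄ (h : i ≤ j) (u : M j),
      tangentMap (I j) (I i) (P.map h) (S j u) = S i (P.map h u))
    (hsm : ∀ i, ContMDiff (I i) (I i).tangent ∞ (S i)) (hproj : ∀ i u, (S i u).proj = u) :
    P.IsVectorField (P.limField S hS) := by
  have htau : ∀ u, P.tau (P.limField S hS u) = u := fun u ↦
    Subtype.ext (funext fun i ↦ hproj i (u.1 i))
  refine ⟨fun c hc t₀ ht₀ ↦ ?_, htau⟩
  -- Since `S` is a section, `S ∘ c` lies over `c`, and a chart adapted to `c` also serves for `S ∘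
  -- c`.
  obtain ⟨φ, hφ, O, hO, ht₀O, hsrc, hsmooth⟩ := hc t₀ ht₀
  have hJ : UniqueDiffOn ℝ (univ ∩ O) := uniqueDiffOn_univ.inter hO
  have hsrc' : ∀ t ∈ univ ∩ O, ∀ i, (((P.limField S hS ∘ c) t).1 i).proj ∈ (φ i).source :=
    fun t ht i ↦ by
      have := hsrc t ht i
      rwa [← hproj i ((c t).1 i)] at this
  refine ⟨φ, hφ, O, hO, ht₀O, hsrc', ?_⟩
  simp only [Function.comp, htau]
  refine hsmooth.prodMk (isSmoothCurveIn_modelLim hJ fun i ↦ ?_)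
  have h1 := (hsm i).comp_contMDiffOn (contMDiffOn_of_isSmoothCurveIn hφ hJ hsrc hsmooth i)
  have h2 := (contMDiffOn_mfderiv_extend (hφ.mem_maximalAtlas i)).comp h1
    fun t ht ↦ hsrc' t ht i
  exact h2.contDiffOn.congr fun t ht ↦ limChartDeriv_apply hφ (hsrc' t ht) i

end ManifoldSystem

/-! ### Limits of strong projective systems of Banach Lie algebroids -/

namespace StrongAlgebroidSystem

variable {B F : ℕ → Type*}
  [∀ i, NormedAddCommGroup (B i)] [∀ i, NormedSpace ℝ (B i)]
  [∀ i, NormedAddCommGroup (F i)] [∀ i, NormedSpace ℝ (F i)]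
  {M : ℕ → Type*} [∀ i, TopologicalSpace (M i)] [∀ i, ChartedSpace (B i) (M i)]
  [∀ i, IsManifold 𝓘(ℝ, B i) ∞ (M i)]
  {E : ∀ i, M i → Type*} [∀ i x, AddCommGroup (E i x)] [∀ i x, Module ℝ (E i x)]
  [∀ i x, TopologicalSpace (E i x)] [∀ i, TopologicalSpace (TotalSpace (F i) (E i))]
  [∀ i, FiberBundle (F i) (E i)] [∀ i, VectorBundle ℝ (F i) (E i)]
  [∀ i, ContMDiffVectorBundle ∞ (F i) (E i) 𝓘(ℝ, B i)]
  {A : ∀ i, BanachLieAlgebroid (B i) (F i) (E i)}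

theorem continuous_proj (P : StrongAlgebroidSystem A) : Continuous P.proj :=
  Continuous.subtype_mk (continuous_pi fun i ↦
    (FiberBundle.continuous_proj (F i) (E i)).comp
      ((continuous_apply i).comp continuous_subtype_val)) _

/-- The total spaces of a strong system of algebroids form a strong system of manifolds: charts of
the base and trivializations combine to charts of the total spaces. -/
theorem isStrong_total (P : StrongAlgebroidSystem A) : P.total.IsStrong := by
  intro u
  obtain ⟨φ, hφ, hxφ⟩ := P.isStrong_base (P.proj u)
  obtain ⟨e, -, hsm, hsm', hxe, hopen, hmaps, hcoh⟩ := P.exists_trivializations (P.proj u)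
  have hprod : ∀ i, (φ i).prod (OpenPartialHomeomorph.refl (F i)) ∈
      IsManifold.maximalAtlas (𝓘(ℝ, B i).prod 𝓘(ℝ, F i)) ∞ (M i × F i) := fun i ↦
    IsManifold.mem_maximalAtlas_prod (hφ.mem_maximalAtlas i)
      (StructureGroupoid.id_mem_maximalAtlas _)
  -- Trivialize over `V_i`, then apply `φ_i × id`. The domain is the part of `E_i` over `U_i ∩ V_i`.
  let ψ : ∀ i, OpenPartialHomeomorph (TotalSpace (F i) (E i)) (ModelProd (B i) (F i)) := fun i ↦
    (e i).toOpenPartialHomeomorph.trans ((φ i).prod (OpenPartialHomeomorph.refl (F i)))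
  have hψ : ∀ i v, v ∈ (ψ i).source ↔ v.proj ∈ (e i).baseSet ∧ v.proj ∈ (φ i).source := by
    intro i v
    constructor
    · rintro ⟨h1, h2⟩
      have h3 : v.proj ∈ (e i).baseSet := (e i).mem_source.1 h1
      refine ⟨h3, ?_⟩
      rw [← (e i).coe_fst' h3]
      exact h2.1
    · rintro ⟨h1, h2⟩
      refine ⟨(e i).mem_source.2 h1, ?_, mem_univ _⟩
      rw [← (e i).coe_fst' h1] at h2
      exact h2
  refine ⟨ψ, ⟨fun i ↦ ?_, fun i j h v hv ↦ ?_, fun i j h v hv ↦ ?_, ?_⟩, fun i ↦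
    (hψ i _).2 ⟨hxe i, hxφ i⟩⟩
  · refine (ψ i).mem_maximalAtlas_of_contMDiffOn ?_ ?_
    · exact (contMDiffOn_of_mem_maximalAtlas (hprod i)).comp ((hsm i).mono inter_subset_left)
        fun v hv ↦ hv.2
    · exact (hsm' i).comp
        ((contMDiffOn_symm_of_mem_maximalAtlas (hprod i)).mono inter_subset_left)
        fun v hv ↦ hv.2
  · have := (hψ j v).1 hv
    exact (hψ i _).2 ⟨hmaps h this.1, hφ.mapsTo h this.2⟩
  -- Coherence splits: the base component comes from the charts `φ_i`, the fibre component from the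
  -- trivializations.
  · have hv' := (hψ j v).1 hv
    have h1 := hcoh h v hv'.1
    have h2 := hφ.coherent h v.proj hv'.2
    rw [← (e j).coe_fst' hv'.1] at h2
    have h3 : (φ i (e i (P.total.map h v)).1, (e i (P.total.map h v)).2) =
        (P.base.modelMap h (φ j (e j v).1), P.typicalMap h (e j v).2) := by
      rw [show e i (P.total.map h v) = _ from h1]
      exact Prod.ext h2 rfl
    exact h3
  · have : {x : P.total.Lim | ∀ i, x.1 i ∈ (ψ i).source} =
        P.proj ⁻¹' ({y | ∀ i, y.1 i ∈ (e i).baseSet} ∩ {y | ∀ i, y.1 i ∈ (φ i).source}) := by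
      ext x
      simp only [mem_ofPred_eq, hψ, mem_preimage, mem_inter_iff, forall_and]
      rfl
    rw [this]
    exact (hopen.inter hφ.isOpen_source).preimage P.continuous_proj

variable {P : StrongAlgebroidSystem A}

theorem hasTangentWithinAt_of_isAdmissibleOn {i : ℕ} {γ : ℝ → TotalSpace (F i) (E i)} {J : Set ℝ}
    (h : (A i).IsAdmissibleOn γ J) {t : ℝ} (ht : t ∈ J) :
    HasTangentWithinAt 𝓘(ℝ, B i) (fun s ↦ (γ s).proj) J t ((A i).rho (γ t)) :=
  ⟨rfl, _, h t ht, one_smul ℝ ((A i).anchor (γ t).proj (γ t).2 : B i)⟩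

/-- If `c' = w` in `lim E_i`, then `(π ∘ c)' = Tπ(w)`. -/
theorem hasVelocityWithinAt_proj {c : ℝ → P.total.Lim} {J : Set ℝ} {t : ℝ} {w : P.total.TLim}
    (h : P.total.HasVelocityWithinAt c J t w) :
    P.base.HasVelocityWithinAt (fun s ↦ P.proj (c s)) J t (P.tangentProj w) :=
  P.isStrong_base.hasVelocityWithinAt fun i ↦
    (h.hasTangentWithinAt i).comp_tangentMap
      ((contMDiff_proj (E i) (n := ∞)).mdifferentiable (by simp) _)

/-- A compatible family of admissible curves has an admissible limit. -/
theorem exists_isAdmissibleOn_lim {J : Set ℝ} (hJ : UniqueDiffOn ℝ J) (hne : J.Nonempty)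
    {γ : ∀ i, ℝ → TotalSpace (F i) (E i)}
    (hγ : ∀ ⦃i j : ℕ⦄ (h : i ≤ j), ∀ t ∈ J, P.total.map h (γ j t) = γ i t)
    (hadm : ∀ i, (A i).IsAdmissibleOn (γ i) J) :
    ∃ c : ℝ → P.total.Lim, (∀ t ∈ J, ∀ i, (c t).1 i = γ i t) ∧ P.IsAdmissibleOn c J ∧
      ((∀ i, ContMDiffOn 𝓘(ℝ) (𝓘(ℝ, B i).prod 𝓘(ℝ, F i)) ∞ (γ i) J) →
        P.total.IsSmoothCurveOn c J) := by
  classical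
  obtain ⟨t₁, ht₁⟩ := hne
  -- The `γ_i t` need not form a thread for `t` outside `J`, so the thread at a fixed time `t₁` of
  -- `J` serves as the default value.
  let c : ℝ → P.total.Lim := fun t ↦
    if ht : t ∈ J then ⟨fun i ↦ γ i t, fun i j h ↦ hγ h t ht⟩
    else ⟨fun i ↦ γ i t₁, fun i j h ↦ hγ h t₁ ht₁⟩
  have hc : ∀ t ∈ J, ∀ i, (c t).1 i = γ i t := fun t ht i ↦ by simp only [c, dif_pos ht]
  refine ⟨c, hc, fun t ht ↦ P.isStrong_base.hasVelocityWithinAt fun i ↦ ?_, fun hsm ↦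
    P.isStrong_total.isSmoothCurveOn hJ fun i ↦ (hsm i).congr fun t ht ↦ hc t ht i⟩
  have h1 := (hasTangentWithinAt_of_isAdmissibleOn (hadm i) ht).congr ht
    (c' := fun s ↦ ((c s).1 i).proj) fun s hs ↦ congrArg TotalSpace.proj (hc s hs i)
  rw [← hc t ht i] at h1
  exact h1

theorem isVectorField_limField
    (S : ∀ i, TotalSpace (F i) (E i) →
      TangentBundle (𝓘(ℝ, B i).prod 𝓘(ℝ, F i)) (TotalSpace (F i) (E i)))
    (hS : ∀ ⦃i j : ℕ⦄ (h : i ≤ j) (u : TotalSpace (F j) (E j)),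
      tangentMap (𝓘(ℝ, B j).prod 𝓘(ℝ, F j)) (𝓘(ℝ, B i).prod 𝓘(ℝ, F i)) (P.total.map h) (S j u) =
        S i (P.total.map h u))
    (hv : ∀ i, BanachLieAlgebroid.IsVectorField (B i) (F i) (S i)) :
    P.total.IsVectorField (P.total.limField S hS) :=
  ManifoldSystem.isVectorField_limField S hS (fun i ↦ (hv i).contMDiff) fun i ↦ (hv i).proj_eq

/-- Integral curves of semisprays are admissible. -/
theorem IsSemispray.isAdmissibleOn {S : P.total.Lim → P.total.TLim} (hS : P.IsSemispray S)
    {c : ℝ → P.total.Lim} {J : Set ℝ} (hc : P.total.IsIntegralCurveOn S c J) :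
    P.IsAdmissibleOn c J := fun t ht ↦ by
  rw [← hS.tangent_eq (c t)]
  exact hasVelocityWithinAt_proj (hc.2 t ht)

/-- If an integral curve of a vector field `S` is admissible, then `Tπ ∘ S = ρ` along it. -/
theorem tangentProj_eq_rho {S : P.total.Lim → P.total.TLim} {c : ℝ → P.total.Lim} {J : Set ℝ}
    (hJ : UniqueDiffOn ℝ J) (hc : P.total.IsIntegralCurveOn S c J) (hadm : P.IsAdmissibleOn c J)
    {t : ℝ} (ht : t ∈ J) : P.tangentProj (S (c t)) = P.rho (c t) :=
  Subtype.ext <| funext fun i ↦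
    -- Both threads are velocities of `π ∘ c` at `t`; uniqueness is applied in each component.
    ((hasVelocityWithinAt_proj (hc.2 t ht)).hasTangentWithinAt i).eq
      ((hadm t ht).hasTangentWithinAt i) (hJ t ht)

end StrongAlgebroidSystem

/-! ### The main theorem -/

theorem mainTheorem2 {B F : ℕ → Type*}
    [∀ i, NormedAddCommGroup (B i)] [∀ i, NormedSpace ℝ (B i)] [∀ i, CompleteSpace (B i)]
    [∀ i, NormedAddCommGroup (F i)] [∀ i, NormedSpace ℝ (F i)] [∀ i, CompleteSpace (F i)]
    {M : ℕ → Type*} [∀ i, TopologicalSpace (M i)] [∀ i, ChartedSpace (B i) (M i)]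
    [∀ i, IsManifold 𝓘(ℝ, B i) ∞ (M i)]
    {E : ∀ i, M i → Type*} [∀ i x, AddCommGroup (E i x)] [∀ i x, Module ℝ (E i x)]
    [∀ i x, TopologicalSpace (E i x)] [∀ i, TopologicalSpace (TotalSpace (F i) (E i))]
    [∀ i, FiberBundle (F i) (E i)] [∀ i, VectorBundle ℝ (F i) (E i)]
    [∀ i, ContMDiffVectorBundle ∞ (F i) (E i) 𝓘(ℝ, B i)]
    (A : ∀ i, BanachLieAlgebroid (B i) (F i) (E i)) (P : StrongAlgebroidSystem A) :
    -- limits of compatible admissible curves, on an interval `J`, are admissible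
    (∀ J : Set ℝ, J.OrdConnected → J.Nontrivial →
      ∀ γ : ∀ i, ℝ → TotalSpace (F i) (E i),
        (∀ ⦃i j : ℕ⦄ (h : i ≤ j), ∀ t ∈ J, P.total.map h (γ j t) = γ i t) →
        (∀ i, (A i).IsAdmissibleOn (γ i) J) →
        ∃ c : ℝ → P.total.Lim, (∀ t ∈ J, ∀ i, (c t).1 i = γ i t) ∧ P.IsAdmissibleOn c J ∧
          ((∀ i, ContMDiffOn 𝓘(ℝ) (𝓘(ℝ, B i).prod 𝓘(ℝ, F i)) ∞ (γ i) J) →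
            P.total.IsSmoothCurveOn c J)) ∧
    -- compatible vector fields `S_i` on `E_i` and their limit `S`
    (∀ (S : ∀ i, TotalSpace (F i) (E i) →
          TangentBundle (𝓘(ℝ, B i).prod 𝓘(ℝ, F i)) (TotalSpace (F i) (E i)))
        (hS : ∀ ⦃i j : ℕ⦄ (h : i ≤ j) (u : TotalSpace (F j) (E j)),
          tangentMap (𝓘(ℝ, B j).prod 𝓘(ℝ, F j)) (𝓘(ℝ, B i).prod 𝓘(ℝ, F i)) (P.total.map h) (S j u) =
            S i (P.total.map h u)),
        (∀ i, BanachLieAlgebroid.IsVectorField (B i) (F i) (S i)) →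
        P.total.IsVectorField (P.total.limField S hS) ∧
        -- a limit of semisprays is a semispray
        ((∀ i, (A i).IsSemispray (S i)) → P.IsSemispray (P.total.limField S hS)) ∧
        -- integral curves are taken on the intervals of an arbitrary family `𝒥` (all nondegenerate
        -- intervals, or `[0, 1]` only)
        ∀ 𝒥 : Set (Set ℝ), (∀ J ∈ 𝒥, J.OrdConnected ∧ J.Nontrivial) →
          -- if the limit field is a semispray, its integral curves are admissible
          (P.IsSemispray (P.total.limField S hS) →
            ∀ J ∈ 𝒥, ∀ c, P.total.IsIntegralCurveOn (P.total.limField S hS) c J →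
              P.IsAdmissibleOn c J) ∧
          -- if its integral curves are admissible, `Tπ ∘ S = ρ` at every point they reach
          ((∀ J ∈ 𝒥, ∀ c, P.total.IsIntegralCurveOn (P.total.limField S hS) c J →
              P.IsAdmissibleOn c J) →
            ∀ J ∈ 𝒥, ∀ c, P.total.IsIntegralCurveOn (P.total.limField S hS) c J → ∀ t ∈ J,
              P.tangentProj (P.total.limField S hS (c t)) = P.rho (c t)) ∧
          -- the equivalence, for limits of semisprays and, more generally, for limits of vector
          -- fields that have an integral curve through every point of `E`
          ((∀ i, (A i).IsSemispray (S i)) ∨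
              (∀ u, ∃ J ∈ 𝒥, ∃ c, P.total.IsIntegralCurveOn (P.total.limField S hS) c J ∧
                ∃ t ∈ J, c t = u) →
            (P.IsSemispray (P.total.limField S hS) ↔
              ∀ J ∈ 𝒥, ∀ c, P.total.IsIntegralCurveOn (P.total.limField S hS) c J →
                P.IsAdmissibleOn c J))) := by
  refine ⟨fun J hJ hn γ hγ hadm ↦ StrongAlgebroidSystem.exists_isAdmissibleOn_lim
    (hJ.uniqueDiffOn_real hn) hn.nonempty hγ hadm, fun S hS hv ↦ ?_⟩
  have hfield := StrongAlgebroidSystem.isVectorField_limField S hS hv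
  have hlim : (∀ i, (A i).IsSemispray (S i)) → P.IsSemispray (P.total.limField S hS) :=
    fun hs ↦ ⟨hfield, fun u ↦ Subtype.ext (funext fun i ↦ (hs i).tangent_eq (u.1 i))⟩
  refine ⟨hfield, hlim, fun 𝒥 h𝒥 ↦ ?_⟩
  have hconv : (∀ J ∈ 𝒥, ∀ c, P.total.IsIntegralCurveOn (P.total.limField S hS) c J →
      P.IsAdmissibleOn c J) → ∀ J ∈ 𝒥, ∀ c,
      P.total.IsIntegralCurveOn (P.total.limField S hS) c J → ∀ t ∈ J,
        P.tangentProj (P.total.limField S hS (c t)) = P.rho (c t) := fun hadm J hJ c hc t ht ↦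
    StrongAlgebroidSystem.tangentProj_eq_rho ((h𝒥 J hJ).1.uniqueDiffOn_real (h𝒥 J hJ).2) hc
      (hadm J hJ c hc) ht
  refine ⟨fun hs J _ c hc ↦ hs.isAdmissibleOn hc, hconv, fun hor ↦
    ⟨fun hs J _ c hc ↦ hs.isAdmissibleOn hc, fun hadm ↦ ?_⟩⟩
  -- For semisprays `S_i` the limit is a semispray without recourse to `hadm`; otherwise each `u` is
  -- some `c t` on an integral curve, where `hconv` applies.
  rcases hor with hs | hreach
  · exact hlim hs
  · refine ⟨hfield, fun u ↦ ?_⟩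
    obtain ⟨J, hJ, c, hc, t, ht, rfl⟩ := hreach u
    exact hconv hadm J hJ c hc t ht
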